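/- Let $p\ge 5$ be a prime. A clause of Res(lin$_{\mathbb{F}_p}$) is a finite set (disjunction) of linear equations $f=0$, where $f$ is a polynomial of degree at most $1$ over $\mathbb{F}_p$ in $x_1,\dots,x_n$. The inference rules are: from $C\vee f=0$ and $D\vee g=0$ infer $C\vee D\vee(\alpha f+\beta g=0)$ for any $\alpha,\beta\in\mathbb{F}_p$ (resolution); from $C\vee a=0$ with $a\in\mathbb{F}_p$, $a\ne 0$, infer $C$ (simplification); from $C$ infer $C\vee f=0$ (weakening). The boolean axioms are $x_i=0\vee x_i=1$. A tree-like Res(lin$_{\mathbb{F}_p}$) refutation of a linear system $Ax=b$ is a derivation tree of the empty clause from the equations of $Ax=b$ (as one-element clauses) and the boolean axioms, and its size is the number of lines, i.e. of nodes of the tree. Let LinSys$^{(p)}$ be the set of pairs $(A,b)$ with $A\in\mathbb{F}_p^{m\times n}$, $b\in\mathbb{F}_p^m$ such that $Ax=b$ has no solution $x\in\{0,1\}^n$, and let $d_A:=\min_{y\ne 0}\omega(yA)$ with $y$ ranging over $\mathbb{F}_p^m$, where $\omega(v)$ is the number of nonzero coordinates of $v$. (1) There is a constant $c>0$ depending only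 on $p$ such that for all $(A,b)\in$ LinSys$^{(p)}$ every tree-like Res(lin$_{\mathbb{F}_p}$) refutation of $Ax=b$ has size at least $2^{c\cdot d_A^{0.2}}$. (2) Put $k_n:=\lceil n/\log_2 p\rceil+1$ and let $(d_n)$ be any sequence of natural numbers with $d_n=\Omega(n/\log_2 n)$. Then there is a constant $c>0$, depending only on $p$ and the sequence $(d_n)$, such that for all $n\ge 2$ and every $(A,b)\in$ LinSys$^{(p)}$ for which $A$ is a $k_n\times n$ generating matrix of an error correcting code over $\mathbb{F}_p$ with parameters $(k_n,n,d_n)$ (that is, the rows of $A$ are linearly independent and any two distinct vectors in their span differ in at least $d_n$ coordinates), every tree-like Res(lin$_{\mathbb{F}_p}$) refutation of $Ax=b$ has size at least $2^{c\cdot(n/\log_2 n)^{0.2}}$. -/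

import Mathlib

open scoped Matrix

/-- The linear polynomial `∑ i, a i * x i + b` over `𝔽_p`, stored as the pair `(a, b)`. -/
abbrev LinPoly (p n : ℕ) : Type := (Fin n → ZMod p) × ZMod p

/-- The constant polynomial `a`. -/
def LinPoly.const {p n : ℕ} (a : ZMod p) : LinPoly p n := (0, a)

/-- The variable `x i`. -/
def LinPoly.var {p n : ℕ} (i : Fin n) : LinPoly p n := (Pi.single i 1, 0)

/-- A clause of Res(lin): the finite disjunction of the equations `f = 0` for `f` in the set. -/
abbrev LinClause (p n : ℕ) : Type := Finset (LinPoly p n)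

/-- Tree-like Res(lin) derivations of a clause from a set `Φ` of clauses.  A derivation is a tree
whose nodes are lines of the proof; every line is an element of `Φ`, a boolean axiom
`x i = 0 ∨ x i = 1`, or is inferred from the roots of its own subderivations. -/
inductive TreeResLin {p n : ℕ} (Φ : Set (LinClause p n)) : LinClause p n → Type
  | hyp (D : LinClause p n) (hD : D ∈ Φ) : TreeResLin Φ D
  | boolean (i : Fin n) :
      TreeResLin Φ {LinPoly.var i, LinPoly.var i - LinPoly.const 1}
  | resolution (C D : LinClause p n) (f g : LinPoly p n) (α β : ZMod p) :
      TreeResLin Φ (insert f C) → TreeResLin Φ (insert g D) →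
        TreeResLin Φ (insert (α • f + β • g) (C ∪ D))
  | simplification (C : LinClause p n) (a : ZMod p) (ha : a ≠ 0) :
      TreeResLin Φ (insert (LinPoly.const a) C) → TreeResLin Φ C
  | weakening (C : LinClause p n) (f : LinPoly p n) :
      TreeResLin Φ C → TreeResLin Φ (insert f C)

/-- The size of a tree-like derivation: the number of its lines (nodes of the tree). -/
def TreeResLin.size {p n : ℕ} {Φ : Set (LinClause p n)} :
    {C : LinClause p n} → TreeResLin Φ C → ℕ
  | _, .hyp _ _ => 1
  | _, .boolean _ => 1
  | _, .resolution _ _ _ _ _ _ π₁ π₂ => π₁.size + π₂.size + 1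
  | _, .simplification _ _ _ π => π.size + 1
  | _, .weakening _ _ π => π.size + 1

/-- The linear system `A x = b` as a set of one-equation clauses, one for each row. -/
def systemClauses {p m n : ℕ} (A : Matrix (Fin m) (Fin n) (ZMod p)) (b : Fin m → ZMod p) :
    Set (LinClause p n) :=
  Set.range fun i => {((A i, - b i) : LinPoly p n)}

/-- A tree-like Res(lin) refutation of `A x = b`: a tree-like derivation of the empty clause. -/
abbrev TreeRefutation {p m n : ℕ} (A : Matrix (Fin m) (Fin n) (ZMod p)) (b : Fin m → ZMod p) :
    Type :=
  TreeResLin (systemClauses A b) ∅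

/-- The pairs `(A, b)` such that `A x = b` has no solution `x` in `{0,1}ⁿ`. -/
def LinSys (p m n : ℕ) : Set (Matrix (Fin m) (Fin n) (ZMod p) × (Fin m → ZMod p)) :=
  {S | ∀ x : Fin n → ZMod p, (∀ j, x j = 0 ∨ x j = 1) → S.1 *ᵥ x ≠ S.2}

/-- `d_A`: the least number of nonzero coordinates of `y A` over all `y ≠ 0`. -/
noncomputable def codeDist {p m n : ℕ} (A : Matrix (Fin m) (Fin n) (ZMod p)) : ℕ :=
  sInf {w | ∃ y : Fin m → ZMod p, y ≠ 0 ∧ w = hammingNorm (y ᵥ* A)}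

/-- `A` is a generating matrix of a linear error correcting code in `𝔽_pⁿ` with parameters
`(k, n, d)`: its `k` rows form a basis of the code, and any two distinct codewords
differ in at least `d` coordinates. -/
def IsECCGenerator {p k n : ℕ} (A : Matrix (Fin k) (Fin n) (ZMod p)) (d : ℕ) : Prop :=
  LinearIndependent (ZMod p) A.row ∧
    ∀ u ∈ Submodule.span (ZMod p) (Set.range A.row),
      ∀ v ∈ Submodule.span (ZMod p) (Set.range A.row), u ≠ v → d ≤ hammingDist u v

/-- The 0-1 unsatisfiable systems whose matrix generates a code with parameters `(k, n, d)`. -/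
def ECC (p n k d : ℕ) : Set (Matrix (Fin k) (Fin n) (ZMod p) × (Fin k → ZMod p)) :=
  {S | S ∈ LinSys p k n ∧ IsECCGenerator S.1 d}

/-- The code dimension `k_n = ⌈n / log₂ p⌉ + 1`. -/
noncomputable def eccDim (p n : ℕ) : ℕ := ⌈(Real.logb 2 p)⁻¹ * n⌉₊ + 1

/-!
The lower bound is a prover–delayer argument.  A clause `f₁ = 0 ∨ … ∨ fₖ = 0` is falsified by the
inequations `fᵢ ≠ 0`, and a falsified conclusion of the resolution rule has a falsified premise.
Following such premises from the root of a refutation, the delayer keeps a space `W` of equations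
that contains the rows of the system, and wants to meet many nodes at which both premises can be
falsified, each time at the price of one more dimension of `W`.  If this happens `T` times along
every path followed, then the tree has at least `2 ^ T` nodes (`TreeResLin.two_pow_le_size`).

What the delayer maintains is that `W` is locally satisfiable (`LocallySat`): for every small set
`J` of variables, the equations of `W` in the variables `J` have a common boolean solution.  The
rows themselves are locally satisfiable because, below the distance of the code, no nontrivial
combination of them lives on a small set.  The delayer never gets stuck because local
satisfiability survives prescribing some value of an arbitrary further linear polynomial
(`LocallySat.exists_value`).  This rests on two facts.

* If `W` exceeds the rows by `t` dimensions and `t * D` is small compared to the distance of the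
  code, then there is a set `J` of at most `t * D` variables such that every equation of `W`
  mentions no variable off `J` or at least `D` of them (`MinWeight.exists_closure`).
* A system of `t` linear equations all of whose nontrivial combinations have weight at least `C * t`,
  where `C` depends only on `p`, has a boolean solution (`exists_boolean_zero`).  Indeed, for a
  nontrivial additive character `ψ` of `𝔽_p`, averaging `ψ (a * x)` over `x ∈ {0, 1}` yields a number
  of modulus at most `q < 1` if `a ≠ 0`, so that the number of boolean solutions, written as an
  exponential sum over the combinations of the equations, is dominated by the zero combination.

With `D` of order `t`, distance of order `T ^ 2` is enough for `T` rounds, which gives a bound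
`2 ^ Ω(√d)` and a fortiori one with exponent `d ^ 0.2`.  The bound for codes follows, since the
distance of the code generated by `A` is `codeDist A`.
-/

/-! ### Evaluation and support of linear polynomials -/

/-- Evaluation of linear polynomials at the point `x`, as a linear functional of the polynomial. -/
def LinPoly.evalAt {p n : ℕ} (x : Fin n → ZMod p) : LinPoly p n →ₗ[ZMod p] ZMod p where
  toFun w := w.1 ⬝ᵥ x + w.2
  map_add' v w := by simp only [Prod.fst_add, Prod.snd_add, add_dotProduct]; ring
  map_smul' a w := by simp [smul_dotProduct, mul_add]

theorem LinPoly.evalAt_apply {p n : ℕ} (x : Fin n → ZMod p) (w : LinPoly p n) :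
    LinPoly.evalAt x w = w.1 ⬝ᵥ x + w.2 := rfl

/-- The set of variables that occur in a linear polynomial. -/
def LinPoly.support {p n : ℕ} (w : LinPoly p n) : Finset (Fin n) :=
  Finset.univ.filter fun i => w.1 i ≠ 0

theorem LinPoly.mem_support {p n : ℕ} {w : LinPoly p n} {i : Fin n} :
    i ∈ LinPoly.support w ↔ w.1 i ≠ 0 := by
  simp [LinPoly.support]

/-- The linear polynomials in the variables from `J`. -/
def polysOn (p : ℕ) {n : ℕ} (J : Finset (Fin n)) : Submodule (ZMod p) (LinPoly p n) where
  carrier := {w | ∀ i ∉ J, w.1 i = 0}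
  add_mem' hv hw i hi := by simp [hv i hi, hw i hi]
  zero_mem' i _ := rfl
  smul_mem' a w hw i hi := by simp [hw i hi]

theorem mem_polysOn {p n : ℕ} {J : Finset (Fin n)} {w : LinPoly p n} :
    w ∈ polysOn p J ↔ ∀ i ∉ J, w.1 i = 0 := Iff.rfl

theorem polysOn_mono {p n : ℕ} {J K : Finset (Fin n)} (h : J ⊆ K) :
    polysOn p J ≤ polysOn p K := fun _ hw i hi => hw i fun hJ => hi (h hJ)

theorem sdiff_support_eq_empty_iff {p n : ℕ} {J : Finset (Fin n)} {w : LinPoly p n} :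
    LinPoly.support w \ J = ∅ ↔ w ∈ polysOn p J := by
  rw [Finset.sdiff_eq_empty_iff_subset, mem_polysOn]
  refine ⟨fun h i hi => by_contra fun h0 => hi (h (LinPoly.mem_support.2 h0)), fun h i hi => ?_⟩
  exact by_contra fun h0 => LinPoly.mem_support.1 hi (h i h0)

/-! ### Boolean solutions of systems of large minimal weight -/

/-- A nontrivial additive character of `ZMod p` is bounded away from `1`, so that averaging it
over a bit contracts by a factor `q < 1` depending only on `p`. -/
theorem exists_norm_one_add_stdAddChar_le (p : ℕ) [NeZero p] :
    ∃ q : ℝ, 0 < q ∧ q < 1 ∧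
      ∀ a : ZMod p, a ≠ 0 → ‖1 + ZMod.stdAddChar a‖ ≤ 2 * q := by
  have hlt : ∀ a : ZMod p, a ≠ 0 → ‖1 + ZMod.stdAddChar a‖ < 2 := by
    intro a ha
    have hn : ‖(ZMod.stdAddChar a : ℂ)‖ = 1 := AddChar.norm_apply _ _
    have hne : ¬ SameRay ℝ (1 : ℂ) (ZMod.stdAddChar a) := by
      rw [sameRay_iff_of_norm_eq (by simp [hn])]
      intro h
      exact ha (ZMod.injective_stdAddChar (by rw [← h, AddChar.map_zero_eq_one]))
    have := norm_add_lt_of_not_sameRay hne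
    rw [hn, norm_one] at this
    linarith
  have hev : ∀ᶠ q : ℝ in nhdsWithin 1 (Set.Iio 1),
      ∀ a : ZMod p, a ≠ 0 → ‖1 + ZMod.stdAddChar a‖ ≤ 2 * q := by
    rw [Filter.eventually_all]
    intro a
    by_cases ha : a = 0
    · simp [ha]
    have h1 : ‖1 + ZMod.stdAddChar a‖ / 2 < 1 := by linarith [hlt a ha]
    filter_upwards [mem_nhdsWithin_of_mem_nhds (Ioi_mem_nhds h1)] with q hq _
    have : ‖1 + ZMod.stdAddChar a‖ / 2 < q := hq
    linarith
  have hpos : ∀ᶠ q : ℝ in nhdsWithin 1 (Set.Iio 1), 0 < q :=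
    mem_nhdsWithin_of_mem_nhds (Ioi_mem_nhds zero_lt_one)
  have hltone : ∀ᶠ q : ℝ in nhdsWithin 1 (Set.Iio 1), q < 1 := self_mem_nhdsWithin
  obtain ⟨q, hq, h0, h1⟩ := (hev.and (hpos.and hltone)).exists
  exact ⟨q, h0, h1, hq⟩

/-- The point that agrees with `σ` on `K` and with the indicator function of `S` off `K`. -/
def fillIn {p n : ℕ} (K : Finset (Fin n)) (σ : Fin n → ZMod p) (S : Finset (Fin n)) :
    Fin n → ZMod p := fun i => if i ∈ K then σ i else if i ∈ S then 1 else 0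

theorem evalAt_fillIn {p n : ℕ} (K : Finset (Fin n)) (σ : Fin n → ZMod p) {S : Finset (Fin n)}
    (hS : S ⊆ Kᶜ) (w : LinPoly p n) :
    LinPoly.evalAt (fillIn K σ S) w = (∑ i ∈ K, w.1 i * σ i + w.2) + ∑ i ∈ S, w.1 i := by
  have h1 : ∑ i ∈ K, w.1 i * fillIn K σ S i = ∑ i ∈ K, w.1 i * σ i :=
    Finset.sum_congr rfl fun i hi => by simp [fillIn, hi]
  have h2 : ∑ i ∈ Kᶜ, w.1 i * fillIn K σ S i = ∑ i ∈ S, w.1 i := by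
    rw [← Finset.sum_subset hS]
    · refine Finset.sum_congr rfl fun i hi => ?_
      simp [fillIn, hi, Finset.mem_compl.1 (hS hi)]
    · intro i hi hiS
      simp [fillIn, Finset.mem_compl.1 hi, hiS]
  rw [LinPoly.evalAt_apply, dotProduct, ← Finset.sum_add_sum_compl K, h1, h2]
  ring

/-- A linear system whose nontrivial consequences have, off `K`, either many variables or none,
those of the second kind being satisfied by `σ`, has a boolean solution that agrees with `σ`
on `K`.  The number of solutions is an exponential sum over `V`, in which the consequences with
many variables contribute negligibly. -/
theorem exists_boolean_zero {p n : ℕ} [Fact p.Prime] {q : ℝ} (hq0 : 0 < q)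
    (hq : ∀ a : ZMod p, a ≠ 0 → ‖1 + ZMod.stdAddChar a‖ ≤ 2 * q) (hq1 : q < 1)
    (V : Submodule (ZMod p) (LinPoly p n)) (H : ℕ) (hV : (Nat.card V : ℝ) * q ^ H ≤ 1)
    (K : Finset (Fin n)) (σ : Fin n → ZMod p) (hσ : ∀ i, σ i = 0 ∨ σ i = 1)
    (hw : ∀ w ∈ V, H ≤ (LinPoly.support w \ K).card ∨
      (w ∈ polysOn p K ∧ LinPoly.evalAt σ w = 0)) :
    ∃ x : Fin n → ZMod p, (∀ i, x i = 0 ∨ x i = 1) ∧ ∀ w ∈ V, LinPoly.evalAt x w = 0 := by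
  classical
  by_contra! hno
  set ψ : AddChar (ZMod p) ℂ := ZMod.stdAddChar with hψ
  have hψinj : ∀ a : ZMod p, a ≠ 0 → ψ a ≠ 1 := fun a ha h =>
    ha (ZMod.injective_stdAddChar (h.trans (AddChar.map_zero_eq_one _).symm))
  have : Fintype V := Fintype.ofFinite V
  set β : LinPoly p n → ZMod p := fun w => ∑ i ∈ K, w.1 i * σ i + w.2 with hβ
  have hbool : ∀ S, ∀ i, fillIn K σ S i = 0 ∨ fillIn K σ S i = 1 := by
    intro S i
    unfold fillIn
    split_ifs <;> simp [hσ]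
  -- As no boolean point is a common zero, the characters of `V` given by these points are
  -- nontrivial and sum to zero.
  have hzero : ∀ S, ∑ w : V, ψ (LinPoly.evalAt (fillIn K σ S) (w : LinPoly p n)) = 0 := by
    intro S
    obtain ⟨w, hwV, hw0⟩ := hno _ (hbool S)
    let χ : AddChar V ℂ := ψ.compAddMonoidHom
      ((LinPoly.evalAt (fillIn K σ S)).toAddMonoidHom.comp V.subtype.toAddMonoidHom)
    have hχ : χ ≠ 1 := by
      intro h
      exact hψinj _ hw0 (DFunLike.congr_fun h (⟨w, hwV⟩ : V))
    exact AddChar.sum_eq_zero_of_ne_one hχ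
  have hprod : ∀ w : LinPoly p n,
      ∑ S ∈ (Kᶜ).powerset, ψ (LinPoly.evalAt (fillIn K σ S) w) =
        ψ (β w) * ∏ i ∈ Kᶜ, (1 + ψ (w.1 i)) := by
    intro w
    rw [Finset.prod_one_add, Finset.mul_sum]
    refine Finset.sum_congr rfl fun S hS => ?_
    rw [evalAt_fillIn K σ (Finset.mem_powerset.1 hS), AddChar.map_add_eq_mul]
    exact congrArg (ψ (β w) * ·) (map_prod ψ.toMonoidHom (fun i => Multiplicative.ofAdd (w.1 i)) S)
  have htot : ∑ w : V, ψ (β w) * ∏ i ∈ Kᶜ, (1 + ψ ((w : LinPoly p n).1 i)) = 0 := by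
    simp_rw [← hprod]
    rw [Finset.sum_comm]
    exact Finset.sum_eq_zero fun S _ => hzero S
  set N := (Kᶜ : Finset (Fin n)).card with hN
  have hgood : ∀ w : LinPoly p n, w ∈ polysOn p K → LinPoly.evalAt σ w = 0 →
      ψ (β w) * ∏ i ∈ Kᶜ, (1 + ψ (w.1 i)) = 2 ^ N := by
    intro w h1 h2
    have hβ0 : β w = 0 := by
      rw [← h2, LinPoly.evalAt_apply, dotProduct]
      refine congrArg (· + w.2) ?_
      refine Finset.sum_subset (Finset.subset_univ _) fun i _ hi => ?_
      simp [h1 i hi]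
    rw [hβ0, AddChar.map_zero_eq_one, one_mul, hN]
    refine Finset.prod_eq_pow_card fun i hi => ?_
    rw [h1 i (Finset.mem_compl.1 hi), AddChar.map_zero_eq_one]
    norm_num
  have hbad : ∀ w : LinPoly p n, H ≤ (LinPoly.support w \ K).card →
      ‖ψ (β w) * ∏ i ∈ Kᶜ, (1 + ψ (w.1 i))‖ ≤ 2 ^ N * q ^ H := by
    intro w h1
    have hterm : ∀ i ∈ Kᶜ, ‖1 + ψ (w.1 i)‖ ≤ 2 * (if i ∈ LinPoly.support w then q else 1) := by
      intro i _
      split_ifs with hi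
      · exact hq _ (LinPoly.mem_support.1 hi)
      · refine (norm_add_le _ _).trans ?_
        rw [AddChar.norm_apply, norm_one]
        norm_num
    rw [norm_mul, AddChar.norm_apply, one_mul, norm_prod]
    refine (Finset.prod_le_prod (fun _ _ => norm_nonneg _) hterm).trans ?_
    rw [Finset.prod_mul_distrib, Finset.prod_const, ← Finset.prod_filter, Finset.prod_const]
    have hfil : (Kᶜ).filter (· ∈ LinPoly.support w) = LinPoly.support w \ K := by
      ext i; simp [and_comm]
    rw [hfil]
    exact mul_le_mul_of_nonneg_left (pow_le_pow_of_le_one hq0.le hq1.le h1) (by positivity)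
  have hre : ∀ w : V, -(2 ^ N * q ^ H) ≤
      (ψ (β w) * ∏ i ∈ Kᶜ, (1 + ψ ((w : LinPoly p n).1 i))).re := by
    intro w
    rcases hw w w.2 with h | ⟨h1, h2⟩
    · have := (Complex.abs_re_le_norm _).trans (hbad w h)
      exact (abs_le.1 this).1
    · rw [hgood _ h1 h2]
      have : ((2 : ℂ) ^ N).re = 2 ^ N := by exact_mod_cast Complex.ofReal_re ((2 : ℝ) ^ N)
      rw [this]
      have : 0 ≤ (2 : ℝ) ^ N * q ^ H := by positivity
      have : (0 : ℝ) < 2 ^ N := by positivity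
      linarith
  have hsum := congrArg Complex.re htot
  rw [Complex.re_sum, ← Finset.add_sum_erase _ _ (Finset.mem_univ (0 : V))] at hsum
  have h0 : (ψ (β ((0 : V) : LinPoly p n)) *
      ∏ i ∈ Kᶜ, (1 + ψ (((0 : V) : LinPoly p n).1 i))).re = 2 ^ N := by
    rw [hgood ((0 : V) : LinPoly p n) (Submodule.zero_mem _) (map_zero _)]
    exact_mod_cast Complex.ofReal_re ((2 : ℝ) ^ N)
  have hrest := Finset.card_nsmul_le_sum (Finset.univ.erase (0 : V)) _ _ fun w _ => hre w
  rw [h0] at hsum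
  rw [nsmul_eq_mul, Finset.card_erase_of_mem (Finset.mem_univ _), Finset.card_univ,
    Nat.cast_pred Fintype.card_pos, ← Nat.card_eq_fintype_card] at hrest
  have h2N : (0 : ℝ) < 2 ^ N := by positivity
  have hqH : (0 : ℝ) < 2 ^ N * q ^ H := by positivity
  have hle : (2 : ℝ) ^ N * ((Nat.card V : ℝ) * q ^ H) ≤ 2 ^ N := mul_le_of_le_one_right h2N.le hV
  simp only [Complex.zero_re] at hsum
  nlinarith

/-! ### Local satisfiability and closures -/

/-- The equations `w = 0`, `w ∈ W`, are locally satisfiable: for every set `J` of at most `r`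
variables, some boolean point satisfies all those that mention only variables from `J`. -/
def LocallySat {p n : ℕ} (r : ℕ) (W : Submodule (ZMod p) (LinPoly p n)) : Prop :=
  ∀ J : Finset (Fin n), J.card ≤ r → ∃ x : Fin n → ZMod p, (∀ i, x i = 0 ∨ x i = 1) ∧
    ∀ w ∈ W ⊓ polysOn p J, LinPoly.evalAt x w = 0

theorem LocallySat.anti {p n r : ℕ} {V W : Submodule (ZMod p) (LinPoly p n)} (h : V ≤ W)
    (hW : LocallySat r W) : LocallySat r V := fun J hJ =>
  let ⟨x, hx, hx0⟩ := hW J hJ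
  ⟨x, hx, fun w hw => hx0 w ⟨h hw.1, hw.2⟩⟩

theorem not_locallySat_of_const_mem {p n r : ℕ} {W : Submodule (ZMod p) (LinPoly p n)}
    {a : ZMod p} (ha : a ≠ 0) (h : LinPoly.const a ∈ W) : ¬ LocallySat r W := by
  intro hW
  obtain ⟨x, -, hx⟩ := hW ∅ (Nat.zero_le _)
  have := hx _ ⟨h, fun _ _ => rfl⟩
  simp [LinPoly.evalAt_apply, LinPoly.const] at this
  exact ha this

/-- Every nonzero polynomial of `R` mentions at least `d` variables. -/
def MinWeight {p n : ℕ} (R : Submodule (ZMod p) (LinPoly p n)) (d : ℕ) : Prop :=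
  ∀ J : Finset (Fin n), J.card < d → R ⊓ polysOn p J = ⊥

section
variable {p n : ℕ} [Fact p.Prime] {R W : Submodule (ZMod p) (LinPoly p n)} {d t : ℕ}

theorem MinWeight.locallySat (hR : MinWeight R d) {r : ℕ} (hr : r < d) : LocallySat r R := by
  intro J hJ
  refine ⟨0, fun _ => Or.inl rfl, fun w hw => ?_⟩
  rw [hR J (hJ.trans_lt hr), Submodule.mem_bot] at hw
  rw [hw, map_zero]

theorem MinWeight.finrank_inf_polysOn_le (hR : MinWeight R d) (hRW : R ≤ W)
    (hW : Module.finrank (ZMod p) W ≤ Module.finrank (ZMod p) R + t) {J : Finset (Fin n)}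
    (hJ : J.card < d) : Module.finrank (ZMod p) ↥(W ⊓ polysOn p J) ≤ t := by
  have h := Submodule.finrank_sup_add_finrank_inf_eq R (W ⊓ polysOn p J)
  have h0 : R ⊓ (W ⊓ polysOn p J) = ⊥ :=
    le_bot_iff.1 ((inf_le_inf_left R inf_le_right).trans (hR J hJ).le)
  rw [h0, finrank_bot] at h
  have h1 := Submodule.finrank_mono (sup_le hRW (inf_le_left : W ⊓ polysOn p J ≤ W))
  omega

/-- A space of equations that exceeds `R` by few dimensions has a small closure: a set `J` of
variables off which each of its equations mentions either no variable or at least `D`.  It is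
obtained by adjoining to `J` the variables of a violating equation as long as there is one; each
time the space of equations on `J` gains a dimension, and there are only `t` to be gained. -/
theorem MinWeight.exists_closure (hR : MinWeight R d) (hRW : R ≤ W)
    (hW : Module.finrank (ZMod p) W ≤ Module.finrank (ZMod p) R + t) {D : ℕ}
    (hD : (t + 1) * D < d) :
    ∃ J : Finset (Fin n), J.card ≤ t * D ∧
      ∀ w ∈ W, w ∈ polysOn p J ∨ D ≤ (LinPoly.support w \ J).card := by
  classical
  let F : Finset (Finset (Fin n)) := Finset.univ.filter fun J =>
    J.card < d ∧ J.card ≤ Module.finrank (ZMod p) ↥(W ⊓ polysOn p J) * D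
  have hF : F.Nonempty := ⟨∅, by simp [F]; omega⟩
  obtain ⟨J, hJF, hmax⟩ := F.exists_max_image Finset.card hF
  obtain ⟨hJd, hJ⟩ : J.card < d ∧ J.card ≤ Module.finrank (ZMod p) ↥(W ⊓ polysOn p J) * D := by
    simpa [F] using hJF
  have hJt : J.card ≤ t * D :=
    hJ.trans (Nat.mul_le_mul_right _ (hR.finrank_inf_polysOn_le hRW hW hJd))
  refine ⟨J, hJt, fun w hw => ?_⟩
  by_contra! hcon
  obtain ⟨hwJ, hlt⟩ := hcon
  have hne : (LinPoly.support w \ J).Nonempty := by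
    rw [Finset.nonempty_iff_ne_empty]
    exact fun h => hwJ (sdiff_support_eq_empty_iff.1 h)
  set J' := J ∪ LinPoly.support w with hJ'
  have hcard : J'.card = J.card + (LinPoly.support w \ J).card := by
    rw [hJ', ← Finset.union_sdiff_self_eq_union, Finset.card_union_of_disjoint
      Finset.disjoint_sdiff]
  have hwJ' : w ∈ polysOn p J' := sdiff_support_eq_empty_iff.1
    (Finset.sdiff_eq_empty_iff_subset.2 Finset.subset_union_right)
  have hrank : Module.finrank (ZMod p) ↥(W ⊓ polysOn p J) <
      Module.finrank (ZMod p) ↥(W ⊓ polysOn p J') := by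
    refine Submodule.finrank_lt_finrank_of_lt (lt_of_le_of_ne
      (inf_le_inf_left _ (polysOn_mono Finset.subset_union_left)) fun h => hwJ ?_)
    have : w ∈ W ⊓ polysOn p J' := ⟨hw, hwJ'⟩
    rw [← h] at this
    exact this.2
  have hmem : J' ∈ F := by
    have h1 := Nat.mul_le_mul_right D (Nat.succ_le_of_lt hrank)
    rw [Nat.succ_mul] at h1
    rw [add_mul] at hD
    simp only [F, Finset.mem_filter, Finset.mem_univ, true_and]
    omega
  have := hmax J' hmem
  have := hne.card_pos
  omega

/-! ### Prescribing the value of a linear polynomial -/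

theorem finrank_sup_span_singleton_le (W : Submodule (ZMod p) (LinPoly p n)) (f : LinPoly p n) :
    Module.finrank (ZMod p) ↥(W ⊔ Submodule.span (ZMod p) {f}) ≤
      Module.finrank (ZMod p) W + 1 :=
  (Submodule.finrank_add_le_finrank_add_finrank _ _).trans
    (Nat.add_le_add_left ((finrank_span_le_card {f}).trans (by simp)) _)

theorem evalAt_const (x : Fin n → ZMod p) (a : ZMod p) :
    LinPoly.evalAt x (LinPoly.const a : LinPoly p n) = a := by
  simp [LinPoly.evalAt_apply, LinPoly.const]

theorem support_smul {c : ZMod p} (hc : c ≠ 0) (w : LinPoly p n) :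
    LinPoly.support (c • w) = LinPoly.support w := by
  ext i
  simp [LinPoly.mem_support, hc]

/-- Local satisfiability is preserved under prescribing some value of a further linear
polynomial `f`.  If `f` is congruent modulo `W` to a polynomial with few variables off the closure
of `W`, then the value is read off at a boolean point that satisfies the equations on the
closure; otherwise every value will do. -/
theorem LocallySat.exists_value {q : ℝ} (hq0 : 0 < q)
    (hq : ∀ a : ZMod p, a ≠ 0 → ‖1 + ZMod.stdAddChar a‖ ≤ 2 * q) (hq1 : q < 1) {r H : ℕ}
    (hH : (p : ℝ) ^ (t + 1) * q ^ H ≤ 1) (hR : MinWeight R d) (hRW : R ≤ W)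
    (hW : Module.finrank (ZMod p) W ≤ Module.finrank (ZMod p) R + t)
    (htr : t * (2 * H) ≤ r) (hrd : r + (t + 1) * (2 * H) < d)
    (hsat : LocallySat r W) (f : LinPoly p n) :
    ∃ a : ZMod p, LocallySat r (W ⊔ Submodule.span (ZMod p) {f - LinPoly.const a}) := by
  classical
  obtain ⟨J, hJt, hJ⟩ := hR.exists_closure hRW hW (D := 2 * H) (by omega)
  obtain ⟨ρ, hρ, hρ0⟩ := hsat J (hJt.trans htr)
  -- It suffices to find a small superset `K` of `J` such that `ρ` satisfies the equations on `K`,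
  -- all others having at least `H` variables off `K`.
  have key : ∀ (K : Finset (Fin n)) (a : ZMod p), K.card ≤ t * (2 * H) + H →
      (∀ w ∈ W, ∀ c : ZMod p, H ≤ (LinPoly.support (w + c • (f - LinPoly.const a)) \ K).card ∨
        (w + c • (f - LinPoly.const a) ∈ polysOn p K ∧
          LinPoly.evalAt ρ (w + c • (f - LinPoly.const a)) = 0)) →
      LocallySat r (W ⊔ Submodule.span (ZMod p) {f - LinPoly.const a}) := by
    intro K a hK h L hL
    set W' := W ⊔ Submodule.span (ZMod p) {f - LinPoly.const a} with hW'
    have hrank : Module.finrank (ZMod p) ↥(W' ⊓ polysOn p L) ≤ t + 1 := by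
      refine hR.finrank_inf_polysOn_le (hRW.trans le_sup_left) ?_ (by omega)
      exact (finrank_sup_span_singleton_le _ _).trans (by omega)
    have hp1 : (1 : ℝ) ≤ p := by exact_mod_cast (Fact.out : p.Prime).one_lt.le
    refine exists_boolean_zero hq0 hq hq1 (W' ⊓ polysOn p L) H ?_ K ρ hρ ?_
    · rw [Module.natCard_eq_pow_finrank (K := ZMod p), Nat.card_zmod, Nat.cast_pow]
      refine le_trans ?_ hH
      exact mul_le_mul_of_nonneg_right (pow_le_pow_right₀ hp1 hrank) (by positivity)
    · rintro w ⟨hw, -⟩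
      obtain ⟨w₀, hw₀, y, hy, rfl⟩ := Submodule.mem_sup.1 hw
      obtain ⟨c, rfl⟩ := Submodule.mem_span_singleton.1 hy
      exact h w₀ hw₀ c
  by_cases hv : ∃ v : LinPoly p n, v - f ∈ W ∧ (LinPoly.support v \ J).card ≤ H
  · obtain ⟨v, hvW, hvH⟩ := hv
    set K := J ∪ LinPoly.support v with hK
    have hKcard : K.card ≤ J.card + (LinPoly.support v \ J).card := by
      rw [hK, ← Finset.union_sdiff_self_eq_union]
      exact Finset.card_union_le _ _
    have hvK : v ∈ polysOn p K := sdiff_support_eq_empty_iff.1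
      (Finset.sdiff_eq_empty_iff_subset.2 Finset.subset_union_right)
    refine ⟨LinPoly.evalAt ρ v, key K _ (by omega) fun w hw c => ?_⟩
    set u := w - c • (v - f) with hu
    have hval : LinPoly.evalAt ρ (v - LinPoly.const (LinPoly.evalAt ρ v)) = 0 := by
      rw [map_sub, evalAt_const, sub_self]
    have hvaK : v - LinPoly.const (LinPoly.evalAt ρ v) ∈ polysOn p K :=
      Submodule.sub_mem _ hvK fun _ _ => rfl
    have heq : w + c • (f - LinPoly.const (LinPoly.evalAt ρ v)) =
        u + c • (v - LinPoly.const (LinPoly.evalAt ρ v)) := by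
      rw [hu]; module
    rw [heq]
    have huW : u ∈ W := W.sub_mem hw (W.smul_mem c hvW)
    rcases hJ u huW with h | h
    · right
      refine ⟨add_mem (polysOn_mono Finset.subset_union_left h) (Submodule.smul_mem _ _ hvaK), ?_⟩
      rw [map_add, map_smul, hval, smul_zero, add_zero]
      exact hρ0 u ⟨huW, h⟩
    · left
      have hsub : (LinPoly.support u \ J) \ (LinPoly.support v \ J) ⊆
          LinPoly.support (u + c • (v - LinPoly.const (LinPoly.evalAt ρ v))) \ K := by
        intro i hi
        simp only [Finset.mem_sdiff, LinPoly.mem_support, not_and, not_not] at hi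
        have hiK : i ∉ K := by
          simp only [hK, Finset.mem_union, LinPoly.mem_support, not_or, not_not]
          exact ⟨hi.1.2, by_contra fun h0 => hi.1.2 (hi.2 h0)⟩
        refine Finset.mem_sdiff.2 ⟨LinPoly.mem_support.2 ?_, hiK⟩
        have h0 := hvaK i hiK
        rw [Prod.fst_add, Pi.add_apply, Prod.smul_fst, Pi.smul_apply, h0, smul_zero, add_zero]
        exact hi.1.1
      have h1 := Finset.card_le_card hsub
      have h2 := Finset.le_card_sdiff (LinPoly.support v \ J) (LinPoly.support u \ J)
      omega
  · push Not at hv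
    refine ⟨0, key J 0 (by omega) fun w hw c => ?_⟩
    have h0 : (LinPoly.const 0 : LinPoly p n) = 0 := rfl
    rw [h0, sub_zero]
    by_cases hc : c = 0
    · rw [hc, zero_smul, add_zero]
      rcases hJ w hw with h | h
      · exact Or.inr ⟨h, hρ0 w ⟨hw, h⟩⟩
      · exact Or.inl (by omega)
    · left
      have h1 := hv (c⁻¹ • w + f) (by simpa using W.smul_mem c⁻¹ hw)
      have h2 : LinPoly.support (w + c • f) = LinPoly.support (c⁻¹ • w + f) := by
        rw [← support_smul hc (c⁻¹ • w + f), smul_add, smul_inv_smul₀ hc]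
      rw [h2]
      exact h1.le

end

/-! ### The prover–delayer game -/

/-- The prover–delayer argument.  A subspace `W ⊇ R` records the answers of the delayer; it
falsifies a clause if each of its equations contradicts `W` locally.  At a resolution step, either
`W` already falsifies a premise, or both `f = 0` and some `f = a ≠ 0` may be added to `W`, and the
two extensions falsify one premise each. -/
theorem TreeResLin.two_pow_le_size {p n : ℕ} [Fact p.Prime] {r T : ℕ} (hr : 1 ≤ r)
    {R : Submodule (ZMod p) (LinPoly p n)} {Φ : Set (LinClause p n)}
    (hΦ : ∀ D ∈ Φ, ∃ f ∈ D, f ∈ R)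
    (hext : ∀ (W : Submodule (ZMod p) (LinPoly p n)), R ≤ W →
      Module.finrank (ZMod p) W ≤ Module.finrank (ZMod p) R + (T + 1) → LocallySat r W →
        ∀ f, ∃ a : ZMod p, LocallySat r (W ⊔ Submodule.span (ZMod p) {f - LinPoly.const a}))
    {C : LinClause p n} (π : TreeResLin Φ C) :
    ∀ (t : ℕ) (W : Submodule (ZMod p) (LinPoly p n)), t ≤ T → R ≤ W →
      Module.finrank (ZMod p) W ≤ Module.finrank (ZMod p) R + t → LocallySat r W →
      (∀ h ∈ C, ¬ LocallySat r (W ⊔ Submodule.span (ZMod p) {h})) → 2 ^ (T - t) ≤ π.size := by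
  have mono : ∀ {W W' : Submodule (ZMod p) (LinPoly p n)} {h : LinPoly p n}, W ≤ W' →
      ¬ LocallySat r (W ⊔ Submodule.span (ZMod p) {h}) →
      ¬ LocallySat r (W' ⊔ Submodule.span (ZMod p) {h}) := fun hWW' hW hW' =>
    hW (hW'.anti (sup_le_sup_right hWW' _))
  have mem_self : ∀ (W : Submodule (ZMod p) (LinPoly p n)) (h : LinPoly p n),
      h ∈ W ⊔ Submodule.span (ZMod p) {h} := fun W h =>
    Submodule.mem_sup_right (Submodule.mem_span_singleton_self h)
  -- A contradicted `α f + β g` contradicts `g` once `f = 0` is known.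
  have conseq : ∀ {W : Submodule (ZMod p) (LinPoly p n)} {f g : LinPoly p n} {α β : ZMod p},
      f ∈ W → ¬ LocallySat r (W ⊔ Submodule.span (ZMod p) {α • f + β • g}) →
      ¬ LocallySat r (W ⊔ Submodule.span (ZMod p) {g}) := by
    intro W f g α β hf hfg hg
    refine hfg (hg.anti (sup_le le_sup_left ?_))
    rw [Submodule.span_singleton_le_iff_mem]
    exact add_mem (Submodule.smul_mem _ _ (Submodule.mem_sup_left hf))
      (Submodule.smul_mem _ _ (mem_self W g))
  induction π with
  | hyp D hD =>
    intro t W _ hRW _ hsat hC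
    obtain ⟨f, hfD, hfR⟩ := hΦ D hD
    refine absurd ?_ (hC f hfD)
    rwa [sup_eq_left.2 ((Submodule.span_singleton_le_iff_mem _ _).2 (hRW hfR))]
  | boolean i =>
    intro t W ht hRW hW hsat hC
    obtain ⟨a, ha⟩ := hext W hRW (hW.trans (by omega)) hsat (LinPoly.var i)
    obtain ⟨x, hx, hx0⟩ := ha {i} (by simpa using hr)
    have h0 := hx0 (LinPoly.var i - LinPoly.const a) ⟨mem_self _ _, fun j hj => by
      have hji : j ≠ i := by simpa using hj
      simp [LinPoly.var, LinPoly.const, hji]⟩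
    have hxa : x i = a := by
      rw [map_sub, evalAt_const, sub_eq_zero] at h0
      simpa [LinPoly.evalAt_apply, LinPoly.var] using h0
    rcases hx i with h | h
    · refine absurd ha ?_
      have h1 : LinPoly.const a = (0 : LinPoly p n) := by rw [← hxa, h]; rfl
      rw [h1, sub_zero]
      exact hC _ (by simp)
    · rw [← hxa, h] at ha
      exact absurd ha (hC _ (by simp))
  | resolution C D f g α β π₁ π₂ ih₁ ih₂ =>
    intro t W ht hRW hW hsat hC
    have hfg := hC _ (Finset.mem_insert_self _ _)
    have hCW : ∀ h ∈ C, ¬ LocallySat r (W ⊔ Submodule.span (ZMod p) {h}) := fun h hh =>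
      hC h (Finset.mem_insert_of_mem (Finset.mem_union_left _ hh))
    have hDW : ∀ h ∈ D, ¬ LocallySat r (W ⊔ Submodule.span (ZMod p) {h}) := fun h hh =>
      hC h (Finset.mem_insert_of_mem (Finset.mem_union_right _ hh))
    rw [TreeResLin.size]
    by_cases hf0 : LocallySat r (W ⊔ Submodule.span (ZMod p) {f})
    swap
    · have := ih₁ t W ht hRW hW hsat fun h hh => by
        rcases Finset.mem_insert.1 hh with rfl | hh
        exacts [hf0, hCW h hh]
      omega
    by_cases hfa : ∃ a : ZMod p, a ≠ 0 ∧
        LocallySat r (W ⊔ Submodule.span (ZMod p) {f - LinPoly.const a})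
    · obtain ⟨a, ha, hfa⟩ := hfa
      rcases ht.eq_or_lt with rfl | ht
      · simp
      have hrank : ∀ h, Module.finrank (ZMod p) ↥(W ⊔ Submodule.span (ZMod p) {h}) ≤
          Module.finrank (ZMod p) R + (t + 1) := fun h =>
        (finrank_sup_span_singleton_le W h).trans (by omega)
      have h1 := ih₁ (t + 1) _ ht (hRW.trans le_sup_left) (hrank _) hfa fun h hh => by
        rcases Finset.mem_insert.1 hh with rfl | hh
        · refine not_locallySat_of_const_mem ha ?_
          have h2 := sub_mem (mem_self (W ⊔ Submodule.span (ZMod p) {h - LinPoly.const a}) h)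
            (Submodule.mem_sup_left (mem_self W (h - LinPoly.const a)))
          rwa [sub_sub_cancel] at h2
        · exact mono le_sup_left (hCW h hh)
      have h2 := ih₂ (t + 1) _ ht (hRW.trans le_sup_left) (hrank _) hf0 fun h hh => by
        rcases Finset.mem_insert.1 hh with rfl | hh
        · exact conseq (mem_self W f) (mono le_sup_left hfg)
        · exact mono le_sup_left (hDW h hh)
      have h3 : 2 ^ (T - t) = 2 * 2 ^ (T - (t + 1)) := by
        rw [← pow_succ']
        congr 1
        omega
      omega
    · -- No nonzero value of `f` is possible, so that `W` forces `f = 0`.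
      have := ih₂ t W ht hRW hW hsat fun h hh => by
        rcases Finset.mem_insert.1 hh with rfl | hh
        · intro hg
          obtain ⟨a, ha⟩ := hext _ (hRW.trans le_sup_left)
            ((finrank_sup_span_singleton_le W h).trans (by omega)) hg f
          have ha0 : a = 0 := by
            by_contra ha0
            exact hfa ⟨a, ha0, ha.anti (sup_le_sup_right le_sup_left _)⟩
          subst ha0
          have h0 : (LinPoly.const 0 : LinPoly p n) = 0 := rfl
          rw [h0, sub_zero, sup_right_comm] at ha
          exact conseq (mem_self W f) (mono le_sup_left hfg) ha
        · exact hDW h hh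
      omega
  | simplification C a ha π ih =>
    intro t W ht hRW hW hsat hC
    have := ih t W ht hRW hW hsat fun h hh => by
      rcases Finset.mem_insert.1 hh with rfl | hh
      exacts [not_locallySat_of_const_mem ha (mem_self _ _), hC h hh]
    rw [TreeResLin.size]
    omega
  | weakening C f π ih =>
    intro t W ht hRW hW hsat hC
    have := ih t W ht hRW hW hsat fun h hh => hC h (Finset.mem_insert_of_mem hh)
    rw [TreeResLin.size]
    omega

theorem TreeResLin.size_pos {p n : ℕ} {Φ : Set (LinClause p n)} {C : LinClause p n}
    (π : TreeResLin Φ C) : 0 < π.size := by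
  cases π <;> simp [TreeResLin.size]

theorem TreeResLin.two_le_size {p n : ℕ} {Φ : Set (LinClause p n)} (hΦ : ∅ ∉ Φ)
    {C : LinClause p n} (hC : C = ∅) (π : TreeResLin Φ C) : 2 ≤ π.size := by
  cases π with
  | hyp D hD => exact absurd (hC ▸ hD) hΦ
  | boolean i => simp at hC
  | resolution C D f g α β π₁ π₂ => simp at hC
  | simplification C a ha π =>
    have := π.size_pos
    rw [TreeResLin.size]
    omega
  | weakening C f π => simp at hC

/-! ### Refutations of linear systems -/

/-- The linear polynomials that vanish by the system `A x = b`. -/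
def rowSpan {p m n : ℕ} (A : Matrix (Fin m) (Fin n) (ZMod p)) (b : Fin m → ZMod p) :
    Submodule (ZMod p) (LinPoly p n) :=
  Submodule.span (ZMod p) (Set.range fun i => ((A i, -b i) : LinPoly p n))

theorem codeDist_le {p m n : ℕ} (A : Matrix (Fin m) (Fin n) (ZMod p)) {y : Fin m → ZMod p}
    (hy : y ≠ 0) : codeDist A ≤ hammingNorm (y ᵥ* A) :=
  Nat.sInf_le ⟨y, hy, rfl⟩

theorem minWeight_rowSpan {p m n : ℕ} (A : Matrix (Fin m) (Fin n) (ZMod p))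
    (b : Fin m → ZMod p) : MinWeight (rowSpan A b) (codeDist A) := by
  intro J hJ
  rw [Submodule.eq_bot_iff]
  rintro w ⟨hw, hwJ⟩
  obtain ⟨y, rfl⟩ := (Submodule.mem_span_range_iff_exists_fun (ZMod p)).1 hw
  by_cases hy : y = 0
  · simp [hy]
  have h1 : (∑ i, y i • ((A i, -b i) : LinPoly p n)).1 = y ᵥ* A := by
    rw [Prod.fst_sum]
    ext j
    simp [Matrix.vecMul, dotProduct]
  have h2 : hammingNorm (y ᵥ* A) ≤ J.card := by
    refine Finset.card_le_card fun j hj => ?_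
    by_contra hjJ
    have h3 := hwJ j hjJ
    rw [h1] at h3
    exact (Finset.mem_filter.1 hj).2 h3
  exact absurd (codeDist_le A hy) (by omega)

/-- Refutations of `A x = b` have size at least `2 ^ T` for some `T` of order `√(codeDist A)`. -/
theorem exists_two_pow_le_size (p : ℕ) [Fact p.Prime] :
    ∃ K : ℕ, 0 < K ∧ ∀ (m n : ℕ) (A : Matrix (Fin m) (Fin n) (ZMod p)) (b : Fin m → ZMod p)
      (T : ℕ), K * (T + 2) ^ 2 < codeDist A → ∀ π : TreeRefutation A b, 2 ^ T ≤ π.size := by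
  obtain ⟨q, hq0, hq1, hq⟩ := exists_norm_one_add_stdAddChar_le p
  have hp0 : (0 : ℝ) < p := by exact_mod_cast (Fact.out : p.Prime).pos
  obtain ⟨c, hc⟩ := exists_pow_lt_of_lt_one (inv_pos.2 hp0) hq1
  have hqc : (p : ℝ) * q ^ (c + 1) ≤ 1 := by
    rw [pow_succ]
    have h1 : (p : ℝ) * q ^ c ≤ 1 := by
      have := mul_le_mul_of_nonneg_left hc.le hp0.le
      rwa [mul_inv_cancel₀ hp0.ne'] at this
    calc (p : ℝ) * (q ^ c * q) = (p * q ^ c) * q := by ring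
      _ ≤ 1 * 1 := mul_le_mul h1 hq1.le hq0.le zero_le_one
      _ = 1 := one_mul 1
  refine ⟨4 * (c + 1), by omega, fun m n A b T hT π => ?_⟩
  -- Subspaces of dimension at most `T + 2` over the rows require equations of weight `H`.
  set H := (c + 1) * (T + 2) with hH
  have hHq : (p : ℝ) ^ (T + 1 + 1) * q ^ H ≤ 1 := by
    rw [hH, pow_mul, ← mul_pow]
    exact pow_le_one₀ (by positivity) hqc
  have hR := minWeight_rowSpan A b
  have hHpos : 0 < H := by positivity
  have hd : (T + 1) * (2 * H) + (T + 1 + 1) * (2 * H) < codeDist A := by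
    refine lt_of_le_of_lt ?_ hT
    rw [hH]
    nlinarith
  have hr : 1 ≤ (T + 1) * (2 * H) := Nat.succ_le_of_lt (by positivity)
  refine TreeResLin.two_pow_le_size (T := T) (r := (T + 1) * (2 * H)) (R := rowSpan A b) hr ?_ ?_
    π 0 (rowSpan A b) (Nat.zero_le _) le_rfl le_rfl (hR.locallySat (by omega)) (by simp)
  · rintro D ⟨i, rfl⟩
    exact ⟨_, Finset.mem_singleton_self _, Submodule.subset_span ⟨i, rfl⟩⟩
  · intro W hRW hW hsat f
    exact hsat.exists_value hq0 hq hq1 hHq hR hRW hW le_rfl hd f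

theorem two_le_size_of_treeRefutation {p m n : ℕ} {A : Matrix (Fin m) (Fin n) (ZMod p)}
    {b : Fin m → ZMod p} (π : TreeRefutation A b) : 2 ≤ π.size := by
  refine π.two_le_size ?_ rfl
  rintro ⟨i, hi⟩
  exact Finset.singleton_ne_empty _ hi

/-- The fifth root stands in for the square root; refutations have at least two lines, which covers
the systems with `codeDist A` too small for `exists_two_pow_le_size`. -/
theorem exists_two_rpow_le_size (p : ℕ) [Fact p.Prime] :
    ∃ c : ℝ, 0 < c ∧
      ∀ (m n : ℕ) (A : Matrix (Fin m) (Fin n) (ZMod p)) (b : Fin m → ZMod p)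
        (π : TreeRefutation A b), (2 : ℝ) ^ (c * (codeDist A : ℝ) ^ (0.2 : ℝ)) ≤ (π.size : ℝ) := by
  obtain ⟨K, hK0, hK⟩ := exists_two_pow_le_size p
  have hK1 : (1 : ℝ) ≤ K := by exact_mod_cast hK0
  refine ⟨1 / (17 * K), by positivity, fun m n A b π => ?_⟩
  set u : ℝ := (codeDist A : ℝ) ^ (0.2 : ℝ) with hu
  have hu0 : 0 ≤ u := by positivity
  have hu5 : u ^ 5 = codeDist A := by
    rw [hu, ← Real.rpow_natCast, ← Real.rpow_mul (Nat.cast_nonneg _)]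
    norm_num
  set s : ℝ := 1 / (17 * K) * u with hs
  have hus : u = 17 * K * s := by rw [hs]; field_simp
  have h2 : (2 : ℝ) ≤ π.size := by exact_mod_cast two_le_size_of_treeRefutation π
  by_cases hs1 : s ≤ 1
  · calc (2 : ℝ) ^ s ≤ 2 ^ (1 : ℝ) := Real.rpow_le_rpow_of_exponent_le one_le_two hs1
      _ ≤ π.size := by rwa [Real.rpow_one]
  push Not at hs1
  set T := ⌈s⌉₊ with hT
  have hTs : s ≤ T := Nat.le_ceil s
  have hTs' : (T : ℝ) < s + 1 := Nat.ceil_lt_add_one (by linarith)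
  have hlt : K * (T + 2) ^ 2 < codeDist A := by
    have hT4 : (T : ℝ) + 2 ≤ 4 * s := by linarith
    have hu1 : 1 ≤ u := by rw [hus]; nlinarith
    have h25 : u ^ 2 ≤ u ^ 5 := pow_le_pow_right₀ hu1 (by norm_num)
    have h3 : (K : ℝ) * (T + 2) ^ 2 < u ^ 5 := by
      calc (K : ℝ) * (T + 2) ^ 2 ≤ K * (4 * s) ^ 2 := by gcongr
        _ = 16 * K * s ^ 2 := by ring
        _ < 17 * 17 * (K * K) * s ^ 2 := by
          have : (K : ℝ) ≤ K * K := by nlinarith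
          have : 0 < s ^ 2 := by positivity
          gcongr ?_ * _
          nlinarith
        _ = u ^ 2 := by rw [hus]; ring
        _ ≤ u ^ 5 := h25
    rw [hu5] at h3
    exact_mod_cast h3
  have hsize : ((2 ^ T : ℕ) : ℝ) ≤ π.size := by exact_mod_cast hK m n A b T hlt π
  calc (2 : ℝ) ^ s ≤ 2 ^ (T : ℝ) := Real.rpow_le_rpow_of_exponent_le one_le_two hTs
    _ = ((2 ^ T : ℕ) : ℝ) := by rw [Real.rpow_natCast]; push_cast; rfl
    _ ≤ π.size := hsize

/-! ### Error correcting codes -/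

theorem IsECCGenerator.le_codeDist {p k n d : ℕ} [Fact p.Prime]
    {A : Matrix (Fin k) (Fin n) (ZMod p)} (hA : IsECCGenerator A d) (hk : 0 < k) :
    d ≤ codeDist A := by
  have : NeZero k := ⟨hk.ne'⟩
  refine le_csInf ⟨_, Pi.single 0 1, by simp, rfl⟩ ?_
  rintro w ⟨y, hy, rfl⟩
  have h := hA.2 (y ᵥ* A) ?_ 0 (zero_mem _) ?_
  · rwa [hammingDist_zero_right] at h
  · rw [Matrix.vecMul_eq_sum]
    exact Submodule.sum_mem _ fun i _ => Submodule.smul_mem _ _ (Submodule.subset_span ⟨i, rfl⟩)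
  · intro h0
    refine hy (Matrix.vecMul_injective_iff.2 hA.1 ?_)
    simpa using h0

theorem mainTheorem4 (p : ℕ) [Fact p.Prime] (hp : 5 ≤ p) :
    (∃ c : ℝ, 0 < c ∧
      ∀ (m n : ℕ) (A : Matrix (Fin m) (Fin n) (ZMod p)) (b : Fin m → ZMod p),
        (A, b) ∈ LinSys p m n →
          ∀ π : TreeRefutation A b, (2 : ℝ) ^ (c * (codeDist A : ℝ) ^ (0.2 : ℝ)) ≤ (π.size : ℝ)) ∧
    (∀ d : ℕ → ℕ,
      (fun n : ℕ => (n : ℝ) / Real.logb 2 (n : ℝ)) =O[Filter.atTop] (fun n : ℕ => (d n : ℝ)) →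
        ∃ c : ℝ, 0 < c ∧
          ∀ n : ℕ, 2 ≤ n →
            ∀ (A : Matrix (Fin (eccDim p n)) (Fin n) (ZMod p)) (b : Fin (eccDim p n) → ZMod p),
              (A, b) ∈ ECC p n (eccDim p n) (d n) →
                ∀ π : TreeRefutation A b,
                  (2 : ℝ) ^ (c * ((n : ℝ) / Real.logb 2 (n : ℝ)) ^ (0.2 : ℝ)) ≤ (π.size : ℝ)) := by
  obtain ⟨c, hc, hbound⟩ := exists_two_rpow_le_size p
  refine ⟨⟨c, hc, fun m n A b _ π => hbound m n A b π⟩, fun d hd => ?_⟩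
  obtain ⟨M, hM, hMd⟩ := hd.exists_pos
  obtain ⟨n₀, hn₀⟩ := Filter.eventually_atTop.1 hMd.bound
  have hlog : ∀ n : ℕ, 2 ≤ n → 1 ≤ Real.logb 2 n := fun n hn => by
    rw [Real.le_logb_iff_rpow_le one_lt_two (by positivity), Real.rpow_one]
    exact_mod_cast hn
  -- For `n < n₀` it suffices that refutations have at least two lines.
  refine ⟨min (c / M ^ (0.2 : ℝ)) (1 / (n₀ + 1)), by positivity, fun n hn A b hA π => ?_⟩
  have hlogn := hlog n hn
  set v : ℝ := (n : ℝ) / Real.logb 2 n with hv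
  have hv0 : 0 ≤ v := by positivity
  rcases le_or_gt n₀ n with h | h
  · have h1 : v ≤ M * d n := by
      have := hn₀ n h
      rwa [Real.norm_of_nonneg hv0, Real.norm_of_nonneg (Nat.cast_nonneg _)] at this
    have h2 : (d n : ℝ) ≤ codeDist A := by
      exact_mod_cast hA.2.le_codeDist (Nat.succ_pos _)
    have h3 : v ^ (0.2 : ℝ) ≤ M ^ (0.2 : ℝ) * (codeDist A : ℝ) ^ (0.2 : ℝ) := by
      rw [← Real.mul_rpow hM.le (Nat.cast_nonneg _)]
      exact Real.rpow_le_rpow hv0 (h1.trans (by gcongr)) (by norm_num)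
    refine le_trans (Real.rpow_le_rpow_of_exponent_le one_le_two ?_) (hbound _ n A b π)
    calc min (c / M ^ (0.2 : ℝ)) (1 / (n₀ + 1)) * v ^ (0.2 : ℝ)
        ≤ c / M ^ (0.2 : ℝ) * (M ^ (0.2 : ℝ) * (codeDist A : ℝ) ^ (0.2 : ℝ)) := by
          gcongr
          exact min_le_left _ _
      _ = c * (codeDist A : ℝ) ^ (0.2 : ℝ) := by
          have : (0 : ℝ) < M ^ (0.2 : ℝ) := by positivity
          field_simp
  · have h1 : v ≤ n₀ + 1 := by
      have : (n : ℝ) ≤ n₀ := by exact_mod_cast h.le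
      have : v ≤ n := div_le_self (by positivity) hlogn
      linarith
    have h2 : v ^ (0.2 : ℝ) ≤ n₀ + 1 := by
      calc v ^ (0.2 : ℝ) ≤ (n₀ + 1 : ℝ) ^ (0.2 : ℝ) := Real.rpow_le_rpow hv0 h1 (by norm_num)
        _ ≤ (n₀ + 1 : ℝ) ^ (1 : ℝ) := Real.rpow_le_rpow_of_exponent_le (by simp) (by norm_num)
        _ = n₀ + 1 := Real.rpow_one _
    have h3 : min (c / M ^ (0.2 : ℝ)) (1 / (n₀ + 1)) * v ^ (0.2 : ℝ) ≤ 1 := by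
      calc _ ≤ 1 / ((n₀ : ℝ) + 1) * (n₀ + 1) := by
            gcongr
            exact min_le_right _ _
        _ = 1 := by field_simp
    calc (2 : ℝ) ^ (_ : ℝ) ≤ 2 ^ (1 : ℝ) := Real.rpow_le_rpow_of_exponent_le one_le_two h3
      _ ≤ π.size := by
        rw [Real.rpow_one]
        exact_mod_cast two_le_size_of_treeRefutation π
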